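/- **Language.** Formulas and programs of Converse PDL, in negation normal form, are given by $\varphi ::= \bot \mid \top \mid p \mid \overline{p} \mid \varphi\lor\varphi \mid \varphi\land\varphi \mid \langle\alpha\rangle\varphi \mid [\alpha]\varphi$ and $\alpha ::= a \mid \alpha;\alpha \mid \alpha\cup\alpha \mid \alpha^{*} \mid \varphi?$, where $p$ ranges over propositions and $a$ over actions (atomic programs and their converses; $\breve a$ is the converse of $a$, $\breve{\breve a}=a$). The negation $\overline{\varphi}$ is defined by dualization, leaving programs unchanged. $\mathrm{FL}(\Gamma)$ is the Fischer–Ladner closure of the formulas in $\Gamma$, and $\mathrm{FL}^{\neg}(\Gamma)=\mathrm{FL}(\Gamma)\cup\{\overline\varphi:\varphi\in \mathrm{FL}(\Gamma)\}$. **Sequents.** An annotated formula is $\varphi^{o}$ with $o\in\{u,f\}$ ($f$: in focus, $u$: out of focus). A sequent is a finite set of annotated formulas (read conjunctively) and a split sequent $\Gamma\,\|\,\Delta$ is a pair of sequents, with at most one formula in focus. It is focused if a formula in it is in focus, and unfocused otherwise. **Rules.** Written premises / conclusion, for either component (the other component is an unchanged context, except in the modal rule; the comma is union): axioms: $/\ \varphi^{o},\overline\varphi^{o'},\Gamma$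 (the two formulas may also lie in different components) and $/\ \bot^{o},\Gamma$; $\varphi^u,\psi^u,\Gamma\ /\ (\varphi\land\psi)^u,\Gamma$; $\varphi^u,\Gamma$ and $\psi^u,\Gamma\ /\ (\varphi\lor\psi)^u,\Gamma$; $\langle\alpha\rangle\langle\beta\rangle\varphi^o,\Gamma\ /\ \langle\alpha;\beta\rangle\varphi^o,\Gamma$; $\langle\alpha\rangle\varphi^o,\Gamma$ and $\langle\beta\rangle\varphi^o,\Gamma\ /\ \langle\alpha\cup\beta\rangle\varphi^o,\Gamma$; $\varphi^o,\Gamma$ and $\langle\alpha\rangle\langle\alpha^*\rangle\varphi^o,\Gamma\ /\ \langle\alpha^*\rangle\varphi^o,\Gamma$; $\psi^u,\varphi^o,\Gamma\ /\ \langle\psi?\rangle\varphi^o,\Gamma$; $[\alpha][\beta]\varphi^u,\Gamma\ /\ [\alpha;\beta]\varphi^u,\Gamma$; $[\alpha]\varphi^u,[\beta]\varphi^u,\Gamma\ /\ [\alpha\cup\beta]\varphi^u,\Gamma$; $\varphi^u,[\alpha][\alpha^*]\varphi^u,\Gamma\ /\ [\alpha^*]\varphi^u,\Gamma$; $\overline\psi^u,\Gamma$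 and $\varphi^u,\Gamma\ /\ [\psi?]\varphi^u,\Gamma$; weakening $\Gamma\ /\ \varphi^u,\Gamma$; analytic cut $\varphi^u,\Gamma$ and $\overline\varphi^u,\Gamma\ /\ \Gamma$, for $\varphi\in\mathrm{FL}^{\neg}(\Gamma)$; the rule $\mathsf f$: $\varphi^f,\Gamma\ /\ \varphi^u,\Gamma$ and the rule $\mathsf u$: $\varphi^u,\Gamma\ /\ \varphi^f,\Gamma$, where all formulas of the context (in both components) are out of focus; and the modal rule $\varphi^o,\Gamma'\ /\ \langle a\rangle\varphi^o,\Gamma$, where in each component the context $\Gamma$ is replaced by $\Gamma'=\{\psi^u : [a]\psi\in\Gamma\}\cup\{\langle\breve a\rangle\chi^u : \chi\in\Gamma,\ \langle\breve a\rangle\chi\in\mathrm{FL}^{\neg}(\text{that component of the conclusion})\}$ (annotations in $\Gamma$ are ignored here). The displayed formula of the conclusion of a connective, program or modal rule is its principal formula; the axioms, weakening, cut, $\mathsf f$ and $\mathsf u$ have no principal formula. **Proofs.** A proof $\pi:\mathcal A\vdash\Gamma\,\|\,\Delta$ with assumptions from $\mathcal A$ is a finite tree of split sequents with root $\Gamma\,\|\,\Delta$,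 built with these rules, in which every leaf is an instance of an axiom, or an open leaf labelled with an element of $\mathcal A$, or a discharged repeat. A discharged repeat has a proper ancestor (its companion) with the same label, such that every split sequent on the path from the companion to the repeat is focused, and at some rule application on this path the formula in focus is principal. The proof is *right-focused* if, on every path from the root to an open leaf (both included), the right component of every node is focused. **Lemma.** Let $\mathcal S$ be a finite set of unfocused sequents, $\mathcal A$ a finite set of split sequents, $\alpha$ a program, $q$ a proposition that occurs neither in $\mathcal S$, nor in $\mathcal A$, nor in $\alpha$, let $\chi$ be a formula and $o\in\{u,f\}$. Suppose that for every $\Sigma\in\mathcal S$ there are right-focused proofs $$\pi_\Sigma:\{\Pi\,\|\,q^{f}:\Pi\in\mathcal S\}\vdash\Sigma\,\|\,\langle\alpha\rangle q^{f}\qquad\text{and}\qquad \rho_\Sigma:\mathcal A\vdash\Sigma\,\|\,\chi^{o}.$$ Then for every $\Sigma\in\mathcal S$ there is a right-focused proof of $\Sigma\,\|\,\langle\alpha^{*}\rangle\chi^{o}$ with assumptions from $\mathcal A$. -/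

import Mathlib

universe u v

namespace CPDL

open scoped Classical

/-! ### Formulas and programs of Converse PDL in negation normal form -/

/-- Atomic programs (actions): a name, used forwards, or its converse. -/
inductive Act (C : Type v) : Type v
  | fwd (c : C) : Act C
  | bwd (c : C) : Act C

/-- The converse of an action, an involution without fixed points. -/
def Act.conv {C : Type v} : Act C → Act C
  | .fwd c => .bwd c
  | .bwd c => .fwd c

mutual
/-- Formulas: literals, constants, disjunction, conjunction, diamonds and boxes. -/
inductive Formula (P : Type u) (C : Type v) : Type (max u v)
  | bot : Formula P C
  | top : Formula P C
  | prop (p : P) : Formula P C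
  | nprop (p : P) : Formula P C
  | or (φ ψ : Formula P C) : Formula P C
  | and (φ ψ : Formula P C) : Formula P C
  | dia (α : Program P C) (φ : Formula P C) : Formula P C
  | box (α : Program P C) (φ : Formula P C) : Formula P C
/-- Programs: actions, composition, choice, iteration and tests. -/
inductive Program (P : Type u) (C : Type v) : Type (max u v)
  | act (a : Act C) : Program P C
  | seq (α β : Program P C) : Program P C
  | choice (α β : Program P C) : Program P C
  | star (α : Program P C) : Program P C
  | test (φ : Formula P C) : Program P C
end

section

variable {P : Type u} {C : Type v}

/-- The negation of a formula, by dualization. Programs are left unchanged. -/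
def Formula.neg : Formula P C → Formula P C
  | .bot => .top
  | .top => .bot
  | .prop p => .nprop p
  | .nprop p => .prop p
  | .or φ ψ => .and φ.neg ψ.neg
  | .and φ ψ => .or φ.neg ψ.neg
  | .dia α φ => .box α φ.neg
  | .box α φ => .dia α φ.neg

mutual
/-- The proposition `q` occurs (positively or negatively, possibly inside a test) in a formula. -/
def Formula.Occurs (q : P) : Formula P C → Prop
  | .bot => False
  | .top => False
  | .prop p => p = q
  | .nprop p => p = q
  | .or φ ψ => φ.Occurs q ∨ ψ.Occurs q
  | .and φ ψ => φ.Occurs q ∨ ψ.Occurs q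
  | .dia α φ => α.Occurs q ∨ φ.Occurs q
  | .box α φ => α.Occurs q ∨ φ.Occurs q
/-- The proposition `q` occurs in a program. -/
def Program.Occurs (q : P) : Program P C → Prop
  | .act _ => False
  | .seq α β => α.Occurs q ∨ β.Occurs q
  | .choice α β => α.Occurs q ∨ β.Occurs q
  | .star α => α.Occurs q
  | .test φ => φ.Occurs q
end

/-- One step in the generation of the Fischer-Ladner closure. -/
inductive FLStep : Formula P C → Formula P C → Prop
  | or_left (φ ψ) : FLStep (.or φ ψ) φ
  | or_right (φ ψ) : FLStep (.or φ ψ) ψ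
  | and_left (φ ψ) : FLStep (.and φ ψ) φ
  | and_right (φ ψ) : FLStep (.and φ ψ) ψ
  | dia_act (a φ) : FLStep (.dia (.act a) φ) φ
  | dia_seq (α β φ) : FLStep (.dia (.seq α β) φ) (.dia α (.dia β φ))
  | dia_choice_left (α β φ) : FLStep (.dia (.choice α β) φ) (.dia α φ)
  | dia_choice_right (α β φ) : FLStep (.dia (.choice α β) φ) (.dia β φ)
  | dia_star_exit (α φ) : FLStep (.dia (.star α) φ) φ
  | dia_star_loop (α φ) : FLStep (.dia (.star α) φ) (.dia α (.dia (.star α) φ))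
  | dia_test_left (ψ φ) : FLStep (.dia (.test ψ) φ) ψ
  | dia_test_right (ψ φ) : FLStep (.dia (.test ψ) φ) φ
  | box_act (a φ) : FLStep (.box (.act a) φ) φ
  | box_seq (α β φ) : FLStep (.box (.seq α β) φ) (.box α (.box β φ))
  | box_choice_left (α β φ) : FLStep (.box (.choice α β) φ) (.box α φ)
  | box_choice_right (α β φ) : FLStep (.box (.choice α β) φ) (.box β φ)
  | box_star_exit (α φ) : FLStep (.box (.star α) φ) φ
  | box_star_loop (α φ) : FLStep (.box (.star α) φ) (.box α (.box (.star α) φ))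
  | box_test_left (ψ φ) : FLStep (.box (.test ψ) φ) ψ.neg
  | box_test_right (ψ φ) : FLStep (.box (.test ψ) φ) φ

/-! ### Annotated formulas, sequents and split sequents -/

/-- Annotations: out of focus `u`, or in focus `f`. -/
inductive Ann : Type
  | u : Ann
  | f : Ann

/-- Annotated formulas. -/
abbrev AForm (P : Type u) (C : Type v) : Type (max u v) := Formula P C × Ann

/-- Sequents: finite sets of annotated formulas, read conjunctively (a sequent is derived in order
to show that it is unsatisfiable). That at most one formula is in focus is a separate predicate,
required below of every node of a proof. -/
abbrev Sequent (P : Type u) (C : Type v) : Type (max u v) := Finset (AForm P C)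

/-- No formula of the sequent is in focus. -/
def Sequent.Unfocused (Γ : Sequent P C) : Prop := ∀ A ∈ Γ, A.2 = Ann.u

/-- Some formula of the sequent is in focus. -/
def Sequent.Focused (Γ : Sequent P C) : Prop := ∃ A ∈ Γ, A.2 = Ann.f

/-- The proposition `q` occurs in the sequent. -/
def Sequent.Occurs (q : P) (Γ : Sequent P C) : Prop := ∃ A ∈ Γ, A.1.Occurs q

/-- The negation-closed Fischer-Ladner closure of a sequent. -/
def Sequent.FLneg (Γ : Sequent P C) : Set (Formula P C) :=
  {ψ | ∃ A ∈ Γ, ∃ φ, Relation.ReflTransGen FLStep A.1 φ ∧ (ψ = φ ∨ ψ = φ.neg)}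

/-- The two components of a split sequent. -/
inductive Side : Type
  | l : Side
  | r : Side

/-- Split sequents `left ‖ right`. -/
@[ext]
structure SplitSequent (P : Type u) (C : Type v) : Type (max u v) where
  left : Sequent P C
  right : Sequent P C

/-- The component of a split sequent on a given side. -/
def SplitSequent.comp (Δ : SplitSequent P C) : Side → Sequent P C
  | .l => Δ.left
  | .r => Δ.right

/-- Adding formulas to one component. -/
noncomputable def SplitSequent.add (Δ : SplitSequent P C) :
    Side → Sequent P C → SplitSequent P C
  | .l, Γ => ⟨Γ ∪ Δ.left, Δ.right⟩
  | .r, Γ => ⟨Δ.left, Γ ∪ Δ.right⟩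

/-- No formula of the split sequent is in focus. -/
def SplitSequent.Unfocused (Δ : SplitSequent P C) : Prop :=
  Δ.left.Unfocused ∧ Δ.right.Unfocused

/-- Some formula of the split sequent is in focus. -/
def SplitSequent.Focused (Δ : SplitSequent P C) : Prop :=
  Δ.left.Focused ∨ Δ.right.Focused

/-- At most one (occurrence of a) formula of the split sequent is in focus. -/
def SplitSequent.AtMostOneFocus (Δ : SplitSequent P C) : Prop :=
  ∀ s t : Side, ∀ φ ψ : Formula P C, (φ, Ann.f) ∈ Δ.comp s → (ψ, Ann.f) ∈ Δ.comp t →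
    s = t ∧ φ = ψ

/-- The proposition `q` occurs in the split sequent. -/
def SplitSequent.Occurs (q : P) (Δ : SplitSequent P C) : Prop :=
  Δ.left.Occurs q ∨ Δ.right.Occurs q

/-! ### The rules of the split focus calculus -/

/-- The local rules, given by the principal formula of the conclusion and, for each premise, the
set of formulas that replaces it. Only rules for diamonds can act on a formula in focus. -/
inductive LocalRule : AForm P C → List (Sequent P C) → Prop
  | and (φ ψ) : LocalRule (.and φ ψ, .u) [{(φ, .u), (ψ, .u)}]
  | or (φ ψ) : LocalRule (.or φ ψ, .u) [{(φ, .u)}, {(ψ, .u)}]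
  | dia_seq (α β φ o) : LocalRule (.dia (.seq α β) φ, o) [{(.dia α (.dia β φ), o)}]
  | dia_choice (α β φ o) :
      LocalRule (.dia (.choice α β) φ, o) [{(.dia α φ, o)}, {(.dia β φ, o)}]
  | dia_star (α φ o) :
      LocalRule (.dia (.star α) φ, o) [{(φ, o)}, {(.dia α (.dia (.star α) φ), o)}]
  | dia_test (ψ φ o) : LocalRule (.dia (.test ψ) φ, o) [{(ψ, .u), (φ, o)}]
  | box_seq (α β φ) : LocalRule (.box (.seq α β) φ, .u) [{(.box α (.box β φ), .u)}]
  | box_choice (α β φ) :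
      LocalRule (.box (.choice α β) φ, .u) [{(.box α φ, .u), (.box β φ, .u)}]
  | box_star (α φ) :
      LocalRule (.box (.star α) φ, .u) [{(φ, .u), (.box α (.box (.star α) φ), .u)}]
  | box_test (ψ φ) : LocalRule (.box (.test ψ) φ, .u) [{(ψ.neg, .u)}, {(φ, .u)}]

/-- The context of the premise of the modal rule for `a`: all `ψ` with `[a]ψ` in `Γ`, and all
`⟨conv a⟩χ` in the set `K` with `χ` in `Γ`, out of focus. -/
noncomputable def Sequent.modal (a : Act C) (K : Set (Formula P C)) (Γ : Sequent P C) :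
    Sequent P C :=
  Γ.biUnion (fun A =>
    (match A.1 with
      | .box (.act b) ψ => if b = a then {(ψ, Ann.u)} else ∅
      | _ => ∅) ∪
    (if Formula.dia (.act a.conv) A.1 ∈ K then {(Formula.dia (.act a.conv) A.1, Ann.u)} else ∅))

/-- `Rule Δ A Δs`: the split sequent `Δ` follows by an application of a rule from the premises
`Δs`; `A` is the principal formula of the application if it is one of a local rule or of the modal
rule, and `none` for the other rules. Every rule has a left and a right version. -/
inductive Rule : SplitSequent P C → Option (AForm P C) → List (SplitSequent P C) → Prop
  /-- Axiom: a formula and its negation, in the same component or in different ones. -/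
  | ax (Δ : SplitSequent P C) (s t : Side) (φ : Formula P C) (o o' : Ann) :
      (φ, o) ∈ Δ.comp s → (φ.neg, o') ∈ Δ.comp t → Rule Δ none []
  /-- Axiom: falsum. -/
  | bot (Δ : SplitSequent P C) (s : Side) (o : Ann) :
      (Formula.bot, o) ∈ Δ.comp s → Rule Δ none []
  | loc (s : Side) (Δ : SplitSequent P C) (A : AForm P C) (Γs : List (Sequent P C)) :
      LocalRule A Γs → Rule (Δ.add s {A}) (some A) (Γs.map (fun Γ => Δ.add s Γ))
  /-- The modal rule; the formulas `⟨conv a⟩χ` are restricted, in each component, to the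
  negation-closed Fischer-Ladner closure of that component of the conclusion. -/
  | modal (s : Side) (Δ : SplitSequent P C) (a : Act C) (φ : Formula P C) (o : Ann) :
      Rule (Δ.add s {(.dia (.act a) φ, o)}) (some (.dia (.act a) φ, o))
        [SplitSequent.add
          ⟨Δ.left.modal a (Δ.add s {(.dia (.act a) φ, o)}).left.FLneg,
            Δ.right.modal a (Δ.add s {(.dia (.act a) φ, o)}).right.FLneg⟩
          s {(φ, o)}]
  /-- Weakening by a formula out of focus. -/
  | weak (s : Side) (Δ : SplitSequent P C) (φ : Formula P C) :
      Rule (Δ.add s {(φ, .u)}) none [Δ]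
  /-- Analytic cut. -/
  | cut (s : Side) (Δ : SplitSequent P C) (φ : Formula P C) :
      φ ∈ (Δ.comp s).FLneg → Rule Δ none [Δ.add s {(φ, .u)}, Δ.add s {(φ.neg, .u)}]
  /-- The focus rule: from the conclusion to the premise a formula is put in focus. -/
  | focus (s : Side) (Δ : SplitSequent P C) (φ : Formula P C) :
      Δ.Unfocused → Rule (Δ.add s {(φ, .u)}) none [Δ.add s {(φ, .f)}]
  /-- The unfocus rule: from the conclusion to the premise the formula in focus loses its focus. -/
  | unfocus (s : Side) (Δ : SplitSequent P C) (φ : Formula P C) :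
      Δ.Unfocused → Rule (Δ.add s {(φ, .f)}) none [Δ.add s {(φ, .u)}]

/-! ### Cyclic proofs with assumptions -/

/-- Finite trees labelled with split sequents. The leaves `asm` are the open leaves, the leaves
`rep` are discharged repeats; an inner node (or an axiom, when `n = 0`) also records the principal
formula of the rule applied at it, if any. -/
inductive Deriv (P : Type u) (C : Type v) : Type (max u v)
  | asm (Δ : SplitSequent P C) : Deriv P C
  | rep (Δ : SplitSequent P C) : Deriv P C
  | node (Δ : SplitSequent P C) (A : Option (AForm P C)) (n : ℕ) (ch : Fin n → Deriv P C) :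
      Deriv P C

/-- The split sequent at the root. -/
def Deriv.root : Deriv P C → SplitSequent P C
  | .asm Δ => Δ
  | .rep Δ => Δ
  | .node Δ _ _ _ => Δ

/-- A repeat labelled `Δ` with proper ancestors `path` (nearest ancestor first, each with its label
and the principal formula of the rule applied there) is successful: some ancestor, its companion,
has the same label, all split sequents on the path from the companion to the repeat are focused, and
at some rule application on this path the formula in focus is principal. -/
def Successful (path : List (SplitSequent P C × Option (AForm P C))) (Δ : SplitSequent P C) :
    Prop :=
  ∃ (pre : List (SplitSequent P C × Option (AForm P C))) (A : Option (AForm P C))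
    (post : List (SplitSequent P C × Option (AForm P C))),
    path = pre ++ (Δ, A) :: post ∧
      (∀ x ∈ pre ++ [(Δ, A)], x.1.Focused) ∧
      ∃ x ∈ pre ++ [(Δ, A)], ∃ φ : Formula P C, x.2 = some (φ, Ann.f)

/-- The tree is a proof with assumptions `As`, as a subtree of a tree in which its root has the
proper ancestors `path`. -/
def Deriv.Valid (As : Set (SplitSequent P C)) :
    List (SplitSequent P C × Option (AForm P C)) → Deriv P C → Prop
  | _, .asm Δ => Δ.AtMostOneFocus ∧ Δ ∈ As
  | path, .rep Δ => Δ.AtMostOneFocus ∧ Successful path Δ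
  | path, .node Δ A _ ch =>
      Δ.AtMostOneFocus ∧ Rule Δ A (List.ofFn (fun i => (ch i).root)) ∧
        ∀ i, (ch i).Valid As ((Δ, A) :: path)

/-- `π` is a split proof of `Δ` whose open leaves are labelled by assumptions from `As`. -/
def Deriv.IsProof (π : Deriv P C) (As : Set (SplitSequent P C)) (Δ : SplitSequent P C) : Prop :=
  π.root = Δ ∧ π.Valid As []

/-- The list of labels of a path from the root to an open leaf, both included. -/
inductive Deriv.OpenPath : Deriv P C → List (SplitSequent P C) → Prop
  | asm (Δ : SplitSequent P C) : OpenPath (.asm Δ) [Δ]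
  | node (Δ : SplitSequent P C) (A : Option (AForm P C)) (n : ℕ) (ch : Fin n → Deriv P C)
      (i : Fin n) (p : List (SplitSequent P C)) :
      OpenPath (ch i) p → OpenPath (.node Δ A n ch) (Δ :: p)

/-- On every path from the root to an open leaf, the right component of every node is focused. -/
def Deriv.RightFocused (π : Deriv P C) : Prop :=
  ∀ p, π.OpenPath p → ∀ Δ ∈ p, Δ.right.Focused

end

end CPDL

/-!
The proofs `π` are turned into proofs of `⟨α⟩⟨α*⟩χ` by substituting `⟨α*⟩χ` for `q`. Substitution
commutes with dualization and with the Fischer-Ladner steps, so it maps rule applications to rule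
applications. The one exception is the modal rule: after the substitution the closure may be larger,
and the premise may acquire further formulas out of focus. These are removed by weakenings
(`Rule.subst`). The sequents so inserted are focused wherever the sequent above them is, hence
repeats stay successful (`PathSim`), and the open leaves `Π ‖ q` become `Π ‖ ⟨α*⟩χ`, again with
`Π ∈ S` (`Deriv.exists_subst`).

For `χ` in focus, `Σ ‖ ⟨α*⟩χ` follows by the star rule from `Σ ‖ χ`, which `ρ` proves, and from
`Σ ‖ ⟨α⟩⟨α*⟩χ`, to which the instance of `π` applies. Its open leaves are treated in the same way,
until on every branch some `Π ‖ ⟨α*⟩χ` with `Π ∈ S` occurs twice, which happens since `S` is finite.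
Such a repeat can be discharged: the branch between is focused because the `π` are right-focused,
and the star rule at the companion has its principal formula in focus
(`exists_star_proof_aux`).

For `χ` out of focus, the roots of the right-focused `ρ` are unfocused, so the `ρ` have no open
leaves. Then the rules `u` and `f` reduce the claim to the case in focus with no assumptions, where
right-focusedness holds vacuously.
-/

namespace CPDL

open scoped Classical

section

variable {P : Type u} {C : Type v}

/-! ### Substitution of a formula for a proposition -/

mutual
/-- Substitution of the formula `θ` for the proposition `q`, also inside tests; the negated literal
of `q` becomes `θ.neg`. -/
noncomputable def Formula.subst : Formula P C → P → Formula P C → Formula P C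
  | .bot, _, _ => .bot
  | .top, _, _ => .top
  | .prop p, q, θ => if p = q then θ else .prop p
  | .nprop p, q, θ => if p = q then θ.neg else .nprop p
  | .or φ ψ, q, θ => .or (φ.subst q θ) (ψ.subst q θ)
  | .and φ ψ, q, θ => .and (φ.subst q θ) (ψ.subst q θ)
  | .dia α φ, q, θ => .dia (α.subst q θ) (φ.subst q θ)
  | .box α φ, q, θ => .box (α.subst q θ) (φ.subst q θ)
/-- Substitution of the formula `θ` for the proposition `q` in the tests of a program. -/
noncomputable def Program.subst : Program P C → P → Formula P C → Program P C
  | .act a, _, _ => .act a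
  | .seq α β, q, θ => .seq (α.subst q θ) (β.subst q θ)
  | .choice α β, q, θ => .choice (α.subst q θ) (β.subst q θ)
  | .star α, q, θ => .star (α.subst q θ)
  | .test φ, q, θ => .test (φ.subst q θ)
end

theorem Formula.neg_neg : ∀ φ : Formula P C, φ.neg.neg = φ
  | .bot => rfl
  | .top => rfl
  | .prop _ => rfl
  | .nprop _ => rfl
  | .or φ ψ => by simp only [neg, neg_neg φ, neg_neg ψ]
  | .and φ ψ => by simp only [neg, neg_neg φ, neg_neg ψ]
  | .dia _ φ => by simp only [neg, neg_neg φ]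
  | .box _ φ => by simp only [neg, neg_neg φ]

theorem Formula.subst_neg (q : P) (θ : Formula P C) :
    ∀ φ : Formula P C, φ.neg.subst q θ = (φ.subst q θ).neg
  | .bot => by simp only [neg, subst]
  | .top => by simp only [neg, subst]
  | .prop p => by
      by_cases h : p = q <;> simp only [neg, subst, h, if_true, if_false]
  | .nprop p => by
      by_cases h : p = q <;> simp only [neg, subst, h, if_true, if_false, neg_neg]
  | .or φ ψ => by simp only [neg, subst, subst_neg q θ φ, subst_neg q θ ψ]
  | .and φ ψ => by simp only [neg, subst, subst_neg q θ φ, subst_neg q θ ψ]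
  | .dia _ φ => by simp only [neg, subst, subst_neg q θ φ]
  | .box _ φ => by simp only [neg, subst, subst_neg q θ φ]

mutual
theorem Formula.subst_of_not_occurs (q : P) :
    ∀ φ θ : Formula P C, ¬ φ.Occurs q → φ.subst q θ = φ
  | .bot, _, _ => by simp only [Formula.subst]
  | .top, _, _ => by simp only [Formula.subst]
  | .prop p, θ, h => by
      simp only [Formula.Occurs] at h
      simp only [Formula.subst, h, if_false]
  | .nprop p, θ, h => by
      simp only [Formula.Occurs] at h
      simp only [Formula.subst, h, if_false]
  | .or φ ψ, θ, h => by
      simp only [Formula.Occurs, not_or] at h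
      simp only [Formula.subst, φ.subst_of_not_occurs q θ h.1, ψ.subst_of_not_occurs q θ h.2]
  | .and φ ψ, θ, h => by
      simp only [Formula.Occurs, not_or] at h
      simp only [Formula.subst, φ.subst_of_not_occurs q θ h.1, ψ.subst_of_not_occurs q θ h.2]
  | .dia α φ, θ, h => by
      simp only [Formula.Occurs, not_or] at h
      simp only [Formula.subst, α.subst_of_not_occurs q θ h.1, φ.subst_of_not_occurs q θ h.2]
  | .box α φ, θ, h => by
      simp only [Formula.Occurs, not_or] at h
      simp only [Formula.subst, α.subst_of_not_occurs q θ h.1, φ.subst_of_not_occurs q θ h.2]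
theorem Program.subst_of_not_occurs (q : P) :
    ∀ (α : Program P C) (θ : Formula P C), ¬ α.Occurs q → α.subst q θ = α
  | .act _, _, _ => by simp only [Program.subst]
  | .seq α β, θ, h => by
      simp only [Program.Occurs, not_or] at h
      simp only [Program.subst, α.subst_of_not_occurs q θ h.1, β.subst_of_not_occurs q θ h.2]
  | .choice α β, θ, h => by
      simp only [Program.Occurs, not_or] at h
      simp only [Program.subst, α.subst_of_not_occurs q θ h.1, β.subst_of_not_occurs q θ h.2]
  | .star α, θ, h => by
      simp only [Program.Occurs] at h
      simp only [Program.subst, α.subst_of_not_occurs q θ h]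
  | .test φ, θ, h => by
      simp only [Program.Occurs] at h
      simp only [Program.subst, φ.subst_of_not_occurs q θ h]
end

theorem FLStep.subst (q : P) (θ : Formula P C) {φ ψ : Formula P C} (h : FLStep φ ψ) :
    FLStep (φ.subst q θ) (ψ.subst q θ) := by
  cases h <;> simp only [Formula.subst, Program.subst, Formula.subst_neg] <;> constructor

/-- Substitution in an annotated formula. -/
noncomputable def AForm.subst (q : P) (θ : Formula P C) (A : AForm P C) : AForm P C :=
  (A.1.subst q θ, A.2)

/-- Substitution in a sequent. -/
noncomputable def Sequent.subst (q : P) (θ : Formula P C) (Γ : Sequent P C) : Sequent P C :=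
  Γ.image (AForm.subst q θ)

/-- Substitution in both components of a split sequent. -/
noncomputable def SplitSequent.subst (q : P) (θ : Formula P C) (Δ : SplitSequent P C) :
    SplitSequent P C :=
  ⟨Δ.left.subst q θ, Δ.right.subst q θ⟩

section Subst

variable (q : P) (θ : Formula P C)

theorem Sequent.mem_subst {Γ : Sequent P C} {A : AForm P C} :
    A ∈ Γ.subst q θ ↔ ∃ φ o, (φ, o) ∈ Γ ∧ (φ.subst q θ, o) = A := by
  simp [Sequent.subst, AForm.subst]

theorem Sequent.subst_singleton (A : AForm P C) :
    Sequent.subst q θ {A} = {A.subst q θ} := Finset.image_singleton _ _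

theorem Sequent.subst_of_not_occurs {Γ : Sequent P C} (h : ¬ Γ.Occurs q) :
    Γ.subst q θ = Γ := by
  have h' : ∀ A ∈ Γ, A.subst q θ = A := fun A hA => by
    rw [AForm.subst, A.1.subst_of_not_occurs q θ fun hq => h ⟨A, hA, hq⟩]
  rw [Sequent.subst, Finset.image_congr (g := id) fun A hA => h' A hA, Finset.image_id]

theorem Sequent.focused_subst {Γ : Sequent P C} : (Γ.subst q θ).Focused ↔ Γ.Focused := by
  constructor
  · rintro ⟨A, hA, hf⟩
    obtain ⟨φ, o, h, rfl⟩ := (Sequent.mem_subst q θ).1 hA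
    exact ⟨_, h, hf⟩
  · rintro ⟨⟨φ, o⟩, hA, hf⟩
    exact ⟨_, (Sequent.mem_subst q θ).2 ⟨φ, o, hA, rfl⟩, hf⟩

theorem Sequent.Unfocused.subst {Γ : Sequent P C} (h : Γ.Unfocused) :
    (Γ.subst q θ).Unfocused := by
  intro A hA
  obtain ⟨φ, o, h', rfl⟩ := (Sequent.mem_subst q θ).1 hA
  exact h (φ, o) h'

theorem Sequent.FLneg_subst {Γ : Sequent P C} {φ : Formula P C} (h : φ ∈ Γ.FLneg) :
    φ.subst q θ ∈ (Γ.subst q θ).FLneg := by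
  obtain ⟨A, hA, ψ, hψ, h⟩ := h
  refine ⟨A.subst q θ, Finset.mem_image_of_mem _ hA, ψ.subst q θ,
    hψ.lift _ fun _ _ h => h.subst q θ, ?_⟩
  rcases h with rfl | rfl
  · exact Or.inl rfl
  · exact Or.inr (Formula.subst_neg q θ ψ)

theorem SplitSequent.comp_subst (Δ : SplitSequent P C) (s : Side) :
    (Δ.subst q θ).comp s = (Δ.comp s).subst q θ := by
  cases s <;> rfl

theorem SplitSequent.subst_add (Δ : SplitSequent P C) (s : Side) (Γ : Sequent P C) :
    (Δ.add s Γ).subst q θ = (Δ.subst q θ).add s (Γ.subst q θ) := by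
  cases s <;> simp [add, subst, Sequent.subst, Finset.image_union]

theorem SplitSequent.focused_subst {Δ : SplitSequent P C} :
    (Δ.subst q θ).Focused ↔ Δ.Focused :=
  or_congr (Sequent.focused_subst q θ) (Sequent.focused_subst q θ)

theorem SplitSequent.Unfocused.subst {Δ : SplitSequent P C} (h : Δ.Unfocused) :
    (Δ.subst q θ).Unfocused :=
  ⟨h.1.subst q θ, h.2.subst q θ⟩

theorem SplitSequent.AtMostOneFocus.subst {Δ : SplitSequent P C} (h : Δ.AtMostOneFocus) :
    (Δ.subst q θ).AtMostOneFocus := by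
  intro s t φ ψ hφ hψ
  rw [comp_subst, Sequent.mem_subst] at hφ hψ
  obtain ⟨φ', o, hφ, e⟩ := hφ
  obtain ⟨ψ', o', hψ, e'⟩ := hψ
  simp only [Prod.mk.injEq] at e e'
  obtain ⟨rfl, rfl⟩ := e
  obtain ⟨rfl, rfl⟩ := e'
  obtain ⟨hs, rfl⟩ := h s t _ _ hφ hψ
  exact ⟨hs, rfl⟩

end Subst

/-! ### Weakening by formulas out of focus -/

/-- `Δ'` arises from `Δ` by adding one formula out of focus to one component. -/
def WeakStep (Δ Δ' : SplitSequent P C) : Prop :=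
  ∃ (s : Side) (φ : Formula P C), Δ' = Δ.add s {(φ, .u)}

theorem reflTransGen_weakStep_add (Δ : SplitSequent P C) (s : Side) (Γ : Sequent P C)
    (h : Γ.Unfocused) : Relation.ReflTransGen WeakStep Δ (Δ.add s Γ) := by
  induction Γ using Finset.induction_on with
  | empty =>
    have : Δ.add s ∅ = Δ := by cases s <;> simp [SplitSequent.add]
    rw [this]
  | insert A Γ _ ih =>
    refine (ih fun B hB => h B (Finset.mem_insert_of_mem hB)).tail ⟨s, A.1, ?_⟩
    have hA : A = (A.1, Ann.u) := Prod.ext rfl (h A (Finset.mem_insert_self _ _))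
    rw [← hA, Finset.insert_eq]
    cases s <;> simp only [SplitSequent.add, Finset.union_assoc]

theorem WeakStep.mem_f {Δ Δ' : SplitSequent P C} (h : WeakStep Δ Δ') (s : Side)
    (φ : Formula P C) : (φ, Ann.f) ∈ Δ'.comp s ↔ (φ, Ann.f) ∈ Δ.comp s := by
  obtain ⟨t, ψ, rfl⟩ := h
  cases s <;> cases t <;> simp [SplitSequent.add, SplitSequent.comp]

theorem SplitSequent.right_focused_iff {Δ : SplitSequent P C} :
    Δ.right.Focused ↔ ∃ φ, (φ, Ann.f) ∈ Δ.comp .r :=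
  ⟨fun ⟨⟨φ, _⟩, h, e⟩ => ⟨φ, by cases e; exact h⟩, fun ⟨φ, h⟩ => ⟨_, h, rfl⟩⟩

theorem SplitSequent.left_focused_iff {Δ : SplitSequent P C} :
    Δ.left.Focused ↔ ∃ φ, (φ, Ann.f) ∈ Δ.comp .l :=
  ⟨fun ⟨⟨φ, _⟩, h, e⟩ => ⟨φ, by cases e; exact h⟩, fun ⟨φ, h⟩ => ⟨_, h, rfl⟩⟩

theorem WeakStep.right_focused {Δ Δ' : SplitSequent P C} (h : WeakStep Δ Δ') :
    Δ'.right.Focused ↔ Δ.right.Focused := by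
  simp only [SplitSequent.right_focused_iff, h.mem_f]

theorem WeakStep.focused {Δ Δ' : SplitSequent P C} (h : WeakStep Δ Δ') :
    Δ'.Focused ↔ Δ.Focused := by
  simp only [SplitSequent.Focused, SplitSequent.right_focused_iff,
    SplitSequent.left_focused_iff, h.mem_f]

theorem WeakStep.atMostOneFocus {Δ Δ' : SplitSequent P C} (h : WeakStep Δ Δ')
    (hΔ : Δ.AtMostOneFocus) : Δ'.AtMostOneFocus := by
  intro s t φ ψ hφ hψ
  rw [h.mem_f] at hφ hψ
  exact hΔ s t φ ψ hφ hψ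

/-! ### Basic properties of derivations -/

theorem Successful.append {path : List (SplitSequent P C × Option (AForm P C))}
    {Δ : SplitSequent P C} (h : Successful path Δ)
    (base : List (SplitSequent P C × Option (AForm P C))) : Successful (path ++ base) Δ := by
  obtain ⟨pre, A, post, rfl, h⟩ := h
  exact ⟨pre, A, post ++ base, by simp, h⟩

theorem Deriv.Valid.append {As : Set (SplitSequent P C)} {d : Deriv P C}
    (base : List (SplitSequent P C × Option (AForm P C))) :
    ∀ {path : List (SplitSequent P C × Option (AForm P C))},
      d.Valid As path → d.Valid As (path ++ base) := by
  induction d with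
  | asm Δ => exact fun h => h
  | rep Δ => exact fun h => ⟨h.1, h.2.append base⟩
  | node Δ A n ch ih => exact fun h => ⟨h.1, h.2.1, fun i => ih i (h.2.2 i)⟩

theorem Deriv.Valid.atMostOneFocus {As : Set (SplitSequent P C)} {d : Deriv P C}
    {path : List (SplitSequent P C × Option (AForm P C))} (h : d.Valid As path) :
    d.root.AtMostOneFocus := by
  cases d <;> exact h.1

theorem Deriv.OpenPath.root_mem {d : Deriv P C} {p : List (SplitSequent P C)}
    (h : d.OpenPath p) : d.root ∈ p := by
  cases h <;> exact List.mem_cons_self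

/-- The derivation has an open leaf. -/
def Deriv.Open (d : Deriv P C) : Prop := ∃ p, d.OpenPath p

theorem Deriv.open_node {Δ : SplitSequent P C} {A : Option (AForm P C)} {n : ℕ}
    {ch : Fin n → Deriv P C} : (Deriv.node Δ A n ch).Open ↔ ∃ i, (ch i).Open := by
  constructor
  · rintro ⟨_, h⟩
    cases h with
    | node _ _ _ _ i p h => exact ⟨i, p, h⟩
  · rintro ⟨i, p, h⟩
    exact ⟨_, .node Δ A n ch i p h⟩

theorem Deriv.not_open_rep (Δ : SplitSequent P C) : ¬ (Deriv.rep Δ).Open := by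
  rintro ⟨_, h⟩
  cases h

theorem Deriv.RightFocused.of_not_open {d : Deriv P C} (h : ¬ d.Open) : d.RightFocused :=
  fun p hp => (h ⟨p, hp⟩).elim

theorem Deriv.RightFocused.root {d : Deriv P C} (h : d.RightFocused) (ho : d.Open) :
    d.root.right.Focused := by
  obtain ⟨p, hp⟩ := ho
  exact h p hp _ hp.root_mem

theorem Deriv.RightFocused.child {Δ : SplitSequent P C} {A : Option (AForm P C)} {n : ℕ}
    {ch : Fin n → Deriv P C} (h : (Deriv.node Δ A n ch).RightFocused) (i : Fin n) :
    (ch i).RightFocused :=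
  fun _ hp _ hΘ => h _ (.node Δ A n ch i _ hp) _ (List.mem_cons_of_mem _ hΘ)

theorem Deriv.RightFocused.node {Δ : SplitSequent P C} {A : Option (AForm P C)} {n : ℕ}
    {ch : Fin n → Deriv P C} (h : ∀ i, (ch i).RightFocused)
    (hΔ : (Deriv.node Δ A n ch).Open → Δ.right.Focused) :
    (Deriv.node Δ A n ch).RightFocused := by
  intro p hp Θ hΘ
  have ho : (Deriv.node Δ A n ch).Open := ⟨p, hp⟩
  cases hp with
  | node _ _ _ _ i p hp =>
    rcases List.mem_cons.1 hΘ with rfl | hΘ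
    · exact hΔ ho
    · exact h i p hp Θ hΘ

theorem Deriv.Valid.not_open {d : Deriv P C} :
    ∀ {path : List (SplitSequent P C × Option (AForm P C))}, d.Valid ∅ path → ¬ d.Open := by
  induction d with
  | asm Δ => exact fun h => h.2.elim
  | rep Δ => exact fun _ => Deriv.not_open_rep Δ
  | node Δ A n ch ih =>
    intro path h ho
    obtain ⟨i, hi⟩ := Deriv.open_node.1 ho
    exact ih i (h.2.2 i) hi

theorem Deriv.Valid.of_not_open {As Bs : Set (SplitSequent P C)} {d : Deriv P C} :
    ∀ {path : List (SplitSequent P C × Option (AForm P C))},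
      d.Valid As path → ¬ d.Open → d.Valid Bs path := by
  induction d with
  | asm Δ => exact fun _ ho => (ho ⟨_, .asm Δ⟩).elim
  | rep Δ => exact fun h _ => h
  | node Δ A n ch ih =>
    exact fun h ho => ⟨h.1, h.2.1, fun i => ih i (h.2.2 i)
      fun hi => ho (Deriv.open_node.2 ⟨i, hi⟩)⟩

/-- A chain of weakenings, as a segment `W` of ancestors that can be inserted below any derivation
of `Δ`. Every inserted sequent has its focus where `Δ` has it. -/
theorem exists_weakening_path {Δ Δ' : SplitSequent P C}
    (h : Relation.ReflTransGen WeakStep Δ Δ') :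
    ∃ W : List (SplitSequent P C × Option (AForm P C)),
      (∀ x ∈ W, (Δ.Focused → x.1.Focused) ∧ (Δ.right.Focused → x.1.right.Focused)) ∧
      ∀ (As : Set (SplitSequent P C)) (path : List (SplitSequent P C × Option (AForm P C)))
        (d : Deriv P C), d.root = Δ → d.Valid As (W ++ path) → d.RightFocused →
        ∃ d' : Deriv P C, d'.root = Δ' ∧ d'.Valid As path ∧ d'.RightFocused ∧
          (d'.Open → d.Open) := by
  induction h using Relation.ReflTransGen.head_induction_on with
  | refl => exact ⟨[], by simp, fun As path d h1 h2 h3 => ⟨d, h1, h2, h3, id⟩⟩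
  | @head Δ Θ hstep _ ih =>
    obtain ⟨W, hW, ih⟩ := ih
    refine ⟨(Θ, none) :: W, ?_, ?_⟩
    · intro x hx
      rcases List.mem_cons.1 hx with rfl | hx
      · exact ⟨hstep.focused.2, hstep.right_focused.2⟩
      · exact ⟨fun h => (hW x hx).1 (hstep.focused.2 h),
          fun h => (hW x hx).2 (hstep.right_focused.2 h)⟩
    · intro As path d hroot hval hrf
      have hopen : (Deriv.node Θ none 1 fun _ => d).Open → d.Open :=
        fun ho => (Deriv.open_node.1 ho).elim fun _ h => h
      obtain ⟨d', h1, h2, h3, h4⟩ := ih As path (.node Θ none 1 fun _ => d) rfl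
        ⟨hstep.atMostOneFocus (hroot ▸ hval.atMostOneFocus), by
          obtain ⟨s, φ, rfl⟩ := hstep
          simpa [hroot] using Rule.weak s Δ φ, fun _ => hval⟩
        (.node (fun _ => hrf) fun ho =>
          hstep.right_focused.2 (hroot ▸ hrf.root (hopen ho)))
      exact ⟨d', h1, h2, h3, fun ho => hopen (h4 ho)⟩

/-! ### Rules are closed under substitution up to weakening -/

theorem LocalRule.subst (q : P) (θ : Formula P C) {A : AForm P C} {Γs : List (Sequent P C)}
    (h : LocalRule A Γs) : LocalRule (A.subst q θ) (Γs.map (Sequent.subst q θ)) := by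
  cases h <;>
    simp only [List.map_cons, List.map_nil, Sequent.subst, Finset.image_insert,
      Finset.image_singleton, AForm.subst, Formula.subst, Program.subst, Formula.subst_neg] <;>
    constructor

theorem Sequent.mem_modal {a : Act C} {K : Set (Formula P C)} {Γ : Sequent P C}
    {B : AForm P C} : B ∈ Γ.modal a K ↔ ∃ A ∈ Γ,
      (A.1 = .box (.act a) B.1 ∨ (.dia (.act a.conv) A.1 ∈ K ∧ B.1 = .dia (.act a.conv) A.1)) ∧
        B.2 = .u := by
  obtain ⟨B, o⟩ := B
  simp only [Sequent.modal, Finset.mem_biUnion, Finset.mem_union]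
  refine exists_congr fun A => and_congr_right fun _ => ?_
  rw [or_and_right]
  refine or_congr ?_ ?_
  · split
    · rename_i b ψ heq
      rw [heq]
      split
      · subst b
        simp [eq_comm]
      · simp [*]
    · rename_i hne
      simp only [Finset.notMem_empty, false_iff, not_and]
      exact fun h => (hne _ _ h).elim
  · split <;> simp [*]

theorem Sequent.unfocused_modal (a : Act C) (K : Set (Formula P C)) (Γ : Sequent P C) :
    (Γ.modal a K).Unfocused := by
  intro B hB
  obtain ⟨A, _, _, h⟩ := Sequent.mem_modal.1 hB
  exact h

/-- The inclusion can be strict: after the substitution the closure may contain further formulas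
`⟨conv a⟩χ`. -/
theorem Sequent.modal_subst_subset (q : P) (θ : Formula P C) {a : Act C}
    {K K' : Set (Formula P C)} (hK : ∀ φ ∈ K, φ.subst q θ ∈ K') (Γ : Sequent P C) :
    (Γ.modal a K).subst q θ ⊆ (Γ.subst q θ).modal a K' := by
  intro B hB
  obtain ⟨φ, o, h, rfl⟩ := (Sequent.mem_subst q θ).1 hB
  obtain ⟨⟨ψ, o'⟩, hA, h, ho⟩ := Sequent.mem_modal.1 h
  refine Sequent.mem_modal.2 ⟨_, (Sequent.mem_subst q θ).2 ⟨ψ, o', hA, rfl⟩, ?_, ho⟩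
  rcases h with h | ⟨h, h'⟩
  · left
    simp only at h
    simp only [h, Formula.subst, Program.subst]
  · right
    have := hK _ h
    simp only at h'
    simp only [h', Formula.subst, Program.subst] at this ⊢
    exact ⟨this, trivial⟩

/-- A substitution instance of a rule application is again a rule application, with premises that
extend the instances of the original premises by formulas out of focus. Only the modal rule needs
such an extension. -/
theorem Rule.subst (q : P) (θ : Formula P C) {Δ : SplitSequent P C} {A : Option (AForm P C)}
    {Δs : List (SplitSequent P C)} (h : Rule Δ A Δs) :
    ∃ Δs', Rule (Δ.subst q θ) (A.map (AForm.subst q θ)) Δs' ∧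
      List.Forall₂ (fun Θ Θ' => Relation.ReflTransGen WeakStep (Θ.subst q θ) Θ') Δs Δs' := by
  have key : ∀ Δs : List (SplitSequent P C), List.Forall₂
      (fun Θ Θ' => Relation.ReflTransGen WeakStep (Θ.subst q θ) Θ') Δs
        (Δs.map (SplitSequent.subst q θ)) := fun Δs => by
    rw [List.forall₂_map_right_iff]
    exact List.forall₂_same.2 fun _ _ => .refl
  have hsingle : ∀ (Δ : SplitSequent P C) s φ o, (Δ.add s {(φ, o)}).subst q θ =
      (Δ.subst q θ).add s {(φ.subst q θ, o)} := fun Δ s φ o => by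
    rw [SplitSequent.subst_add, Sequent.subst_singleton, AForm.subst]
  cases h with
  | ax _ s t φ o o' h h' =>
    refine ⟨[], .ax _ s t (φ.subst q θ) o o' ?_ ?_, .nil⟩
    · rw [SplitSequent.comp_subst]
      exact (Sequent.mem_subst q θ).2 ⟨_, _, h, rfl⟩
    · rw [SplitSequent.comp_subst]
      exact (Sequent.mem_subst q θ).2 ⟨_, _, h', by rw [Formula.subst_neg]⟩
  | bot _ s o h =>
    refine ⟨[], .bot _ s o ?_, .nil⟩
    rw [SplitSequent.comp_subst]
    exact (Sequent.mem_subst q θ).2 ⟨_, _, h, by simp only [Formula.subst]⟩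
  | loc s Δ A Γs h =>
    refine ⟨_, ?_, key _⟩
    have := Rule.loc s (Δ.subst q θ) _ _ (h.subst q θ)
    simpa only [SplitSequent.subst_add, Sequent.subst_singleton, List.map_map, Function.comp_def,
      Option.map_some] using this
  | modal s Δ a φ o =>
    have hr := Rule.modal s (Δ.subst q θ) a (φ.subst q θ) o
    have hdia : (Formula.dia (.act a) φ).subst q θ = .dia (.act a) (φ.subst q θ) := by
      simp only [Formula.subst, Program.subst]
    rw [← hdia, ← hsingle] at hr
    refine ⟨_, hr, .cons ?_ .nil⟩
    set K := (Δ.add s {(.dia (.act a) φ, o)}).left.FLneg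
    set K' := (Δ.add s {(.dia (.act a) φ, o)}).right.FLneg
    set L := ((Δ.add s {(.dia (.act a) φ, o)}).subst q θ).left.FLneg
    set L' := ((Δ.add s {(.dia (.act a) φ, o)}).subst q θ).right.FLneg
    have hl := Sequent.modal_subst_subset q θ (a := a) (K := K) (K' := L)
      (fun φ h => Sequent.FLneg_subst q θ h) Δ.left
    have hr := Sequent.modal_subst_subset q θ (a := a) (K := K') (K' := L')
      (fun φ h => Sequent.FLneg_subst q θ h) Δ.right
    have h1 := reflTransGen_weakStep_add
      ((SplitSequent.add ⟨Δ.left.modal a K, Δ.right.modal a K'⟩ s {(φ, o)}).subst q θ) .l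
      _ (Sequent.unfocused_modal a L (Δ.left.subst q θ))
    have h2 := h1.trans (reflTransGen_weakStep_add _ .r
      _ (Sequent.unfocused_modal a L' (Δ.right.subst q θ)))
    convert h2 using 1
    rw [hsingle]
    cases s
    · ext1
      · simp only [SplitSequent.add, SplitSequent.subst]
        rw [Finset.union_left_comm, Finset.union_eq_left.2 hl]
      · simp only [SplitSequent.add, SplitSequent.subst]
        rw [Finset.union_eq_left.2 hr]
    · ext1
      · simp only [SplitSequent.add, SplitSequent.subst]
        rw [Finset.union_eq_left.2 hl]
      · simp only [SplitSequent.add, SplitSequent.subst]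
        rw [Finset.union_left_comm, Finset.union_eq_left.2 hr]
  | weak s Δ φ =>
    refine ⟨_, ?_, key _⟩
    rw [hsingle]
    exact .weak s _ _
  | cut s _ φ h =>
    refine ⟨_, ?_, key _⟩
    simp only [List.map_cons, List.map_nil, hsingle, Formula.subst_neg]
    exact .cut s _ _ (by rw [SplitSequent.comp_subst]; exact Sequent.FLneg_subst q θ h)
  | focus s Δ φ h =>
    refine ⟨_, ?_, key _⟩
    simp only [List.map_cons, List.map_nil, hsingle]
    exact .focus s _ _ (h.subst q θ)
  | unfocus s Δ φ h =>
    refine ⟨_, ?_, key _⟩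
    simp only [List.map_cons, List.map_nil, hsingle]
    exact .unfocus s _ _ (h.subst q θ)

/-! ### Substitution in a proof, with derivations plugged into its open leaves -/

/-- Seen from a node labelled `Δ` with ancestors `path`, every ancestor that could be the companion
of a repeat (all sequents down to the node are focused) has its substitution instance among the
ancestors `path'`, where again all sequents in between are focused and where no principal formula
is lost. -/
def PathSim (q : P) (θ : Formula P C) (path path' : List (SplitSequent P C × Option (AForm P C)))
    (Δ : SplitSequent P C) : Prop :=
  ∀ pre Θ A post, path = pre ++ (Θ, A) :: post → (∀ x ∈ pre, x.1.Focused) → Δ.Focused →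
    ∃ pre' post', path' = pre' ++ (Θ.subst q θ, A.map (AForm.subst q θ)) :: post' ∧
      (∀ x ∈ pre', x.1.Focused) ∧
      ∀ x ∈ pre, ∀ B, x.2 = some B → ∃ y ∈ pre', y.2 = some (B.subst q θ)

theorem PathSim.successful {q : P} {θ : Formula P C}
    {path path' : List (SplitSequent P C × Option (AForm P C))} {Δ : SplitSequent P C}
    (h : PathSim q θ path path' Δ) (hs : Successful path Δ) :
    Successful path' (Δ.subst q θ) := by
  obtain ⟨pre, A, post, hp, hf, x, hx, φ, hφ⟩ := hs
  have hΔ : Δ.Focused := hf (Δ, A) (by simp)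
  obtain ⟨pre', post', hp', hf', hB⟩ :=
    h pre Δ A post hp (fun x hx => hf x (by simp [hx])) hΔ
  refine ⟨pre', _, post', hp', ?_, ?_⟩
  · intro y hy
    rcases List.mem_append.1 hy with hy | hy
    · exact hf' y hy
    · rw [List.mem_singleton.1 hy]
      exact (SplitSequent.focused_subst q θ).2 hΔ
  · rcases List.mem_append.1 hx with hx | hx
    · obtain ⟨y, hy, e⟩ := hB x hx _ hφ
      exact ⟨y, List.mem_append_left _ hy, _, e⟩
    · rw [List.mem_singleton.1 hx] at hφ
      refine ⟨_, List.mem_append_right _ (List.mem_singleton_self _), φ.subst q θ, ?_⟩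
      simp only at hφ
      rw [hφ]
      rfl

theorem PathSim.cons {q : P} {θ : Formula P C}
    {path path' W : List (SplitSequent P C × Option (AForm P C))} {Δ Δ' : SplitSequent P C}
    (A : Option (AForm P C)) (h : PathSim q θ path path' Δ)
    (hW : ∀ x ∈ W, Δ'.Focused → x.1.Focused) :
    PathSim q θ ((Δ, A) :: path)
      (W ++ (Δ.subst q θ, A.map (AForm.subst q θ)) :: path') Δ' := by
  intro pre Θ B post hp hf hΔ'
  cases pre with
  | nil =>
    simp only [List.nil_append, List.cons.injEq, Prod.mk.injEq] at hp
    obtain ⟨⟨rfl, rfl⟩, rfl⟩ := hp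
    exact ⟨W, path', rfl, fun x hx => hW x hx hΔ', by simp⟩
  | cons y pre =>
    simp only [List.cons_append, List.cons.injEq] at hp
    obtain ⟨rfl, hp⟩ := hp
    have hΔ : Δ.Focused := hf _ List.mem_cons_self
    obtain ⟨pre', post', rfl, hf', hB⟩ :=
      h pre Θ B post hp (fun x hx => hf x (List.mem_cons_of_mem _ hx)) hΔ
    refine ⟨W ++ (Δ.subst q θ, A.map (AForm.subst q θ)) :: pre', post', by simp, ?_, ?_⟩
    · intro x hx
      rcases List.mem_append.1 hx with hx | hx
      · exact hW x hx hΔ'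
      · rcases List.mem_cons.1 hx with rfl | hx
        · exact (SplitSequent.focused_subst q θ).2 hΔ
        · exact hf' x hx
    · intro x hx D hD
      rcases List.mem_cons.1 hx with rfl | hx
      · refine ⟨_, List.mem_append_right _ List.mem_cons_self, ?_⟩
        simp only at hD
        rw [hD]
        rfl
      · obtain ⟨y, hy, e⟩ := hB x hx D hD
        exact ⟨y, List.mem_append_right _ (List.mem_cons_of_mem _ hy), e⟩

/-- Substitution in a right-focused derivation `d` with ancestors `path`. The instance stands above
`L ++ base`, where `L` belongs to the instance of the proof around `d`; every open leaf of `d` is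
replaced by a derivation that may use all ancestors, of which those outside `base` have a focused
right component. -/
theorem Deriv.exists_subst (q : P) (θ : Formula P C) {As Bs : Set (SplitSequent P C)}
    {base : List (SplitSequent P C × Option (AForm P C))}
    (hclose : ∀ Δ ∈ As, ∀ L : List (SplitSequent P C × Option (AForm P C)),
      (∀ x ∈ L, x.1.right.Focused) → ∃ d' : Deriv P C,
        d'.root = Δ.subst q θ ∧ d'.Valid Bs (L ++ base) ∧ d'.RightFocused)
    (d : Deriv P C) :
    ∀ path L : List (SplitSequent P C × Option (AForm P C)),
      d.Valid As path → d.RightFocused → PathSim q θ path (L ++ base) d.root →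
      (d.Open → ∀ x ∈ L, x.1.right.Focused) →
      ∃ d' : Deriv P C, d'.root = d.root.subst q θ ∧ d'.Valid Bs (L ++ base) ∧
        d'.RightFocused ∧ (d'.Open → d.Open) := by
  induction d with
  | asm Δ =>
    intro path L hv _ _ hL
    have ho : (Deriv.asm Δ).Open := ⟨_, .asm Δ⟩
    obtain ⟨d', h1, h2, h3⟩ := hclose Δ hv.2 L (hL ho)
    exact ⟨d', h1, h2, h3, fun _ => ho⟩
  | rep Δ =>
    intro path L hv _ hsim _
    exact ⟨.rep (Δ.subst q θ), rfl, ⟨hv.1.subst q θ, hsim.successful hv.2⟩,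
      .of_not_open (not_open_rep _), fun h => (not_open_rep _ h).elim⟩
  | node Δ A n ch ih =>
    intro path L hv hrf hsim hL
    obtain ⟨hamo, hrule, hch⟩ := hv
    obtain ⟨Δs', hrule', hall⟩ := hrule.subst q θ
    have hlen : Δs'.length = n := by simpa using hall.length_eq.symm
    subst hlen
    have hext : ∀ i : Fin Δs'.length,
        Relation.ReflTransGen WeakStep ((ch i).root.subst q θ) (Δs'.get i) := fun i => by
      have := hall.get (i := i) (by simp) i.2
      simpa using this
    have hsub : ∀ i : Fin Δs'.length, ∃ d' : Deriv P C, d'.root = Δs'.get i ∧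
        d'.Valid Bs ((Δ.subst q θ, A.map (AForm.subst q θ)) :: (L ++ base)) ∧
        d'.RightFocused ∧ (d'.Open → (ch i).Open) := by
      intro i
      obtain ⟨W, hW, hweak⟩ := exists_weakening_path (hext i)
      have hopen : (ch i).Open → (Deriv.node Δ A _ ch).Open := fun h => open_node.2 ⟨i, h⟩
      obtain ⟨d', h1, h2, h3, h4⟩ := ih i ((Δ, A) :: path)
        (W ++ (Δ.subst q θ, A.map (AForm.subst q θ)) :: L) (hch i) (hrf.child i)
        (by
          rw [List.append_assoc, List.cons_append]
          exact hsim.cons A fun x hx h =>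
            (hW x hx).1 ((SplitSequent.focused_subst q θ).2 h))
        (by
          intro ho x hx
          rcases List.mem_append.1 hx with hx | hx
          · exact (hW x hx).2 ((Sequent.focused_subst q θ).2 ((hrf.child i).root ho))
          · rcases List.mem_cons.1 hx with rfl | hx
            · exact (Sequent.focused_subst q θ).2 (hrf.root (hopen ho))
            · exact hL (hopen ho) x hx)
      rw [List.append_assoc, List.cons_append] at h2
      obtain ⟨d'', h1', h2', h3', h4'⟩ := hweak Bs _ d' h1 h2 h3
      exact ⟨d'', h1', h2', h3', fun h => h4 (h4' h)⟩
    choose ch' hroot hval hrf' hop using hsub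
    have hopen : (Deriv.node (Δ.subst q θ) (A.map (AForm.subst q θ)) _ ch').Open →
        (Deriv.node Δ A _ ch).Open := fun h => by
      obtain ⟨i, hi⟩ := open_node.1 h
      exact open_node.2 ⟨i, hop i hi⟩
    refine ⟨.node (Δ.subst q θ) (A.map (AForm.subst q θ)) _ ch', rfl,
      ⟨hamo.subst q θ, ?_, hval⟩, .node hrf' fun ho => ?_, hopen⟩
    · have : (List.ofFn fun i => (ch' i).root) = Δs' := by
        simp only [hroot]
        exact List.ofFn_get Δs'
      rw [this]
      exact hrule'
    · exact (Sequent.focused_subst q θ).2 (hrf.root (hopen ho))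

/-! ### Unfolding the iteration -/

theorem atMostOneFocus_singleton {Γ : Sequent P C} (h : Γ.Unfocused) (A : AForm P C) :
    SplitSequent.AtMostOneFocus ⟨Γ, {A}⟩ := by
  have hl : ∀ φ, (φ, Ann.f) ∉ Γ := fun φ hφ => by simpa using h _ hφ
  intro s t φ ψ hφ hψ
  cases s
  · exact (hl _ hφ).elim
  cases t
  · exact (hl _ hψ).elim
  simp only [SplitSequent.comp, Finset.mem_singleton] at hφ hψ
  exact ⟨rfl, congrArg Prod.fst (hφ.trans hψ.symm)⟩

/-- The construction for `⟨α*⟩χ` in focus. `V` is the set of those `Θ` for which `Θ ‖ ⟨α*⟩χ` has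
already been unfolded at an ancestor that can serve as a companion; the recursion is on the number
of the other members of `S`. -/
theorem exists_star_proof_aux (S : Finset (Sequent P C)) (Bs : Set (SplitSequent P C))
    (α : Program P C) (q : P) (χ : Formula P C)
    (hS : ∀ Γ ∈ S, Γ.Unfocused) (hqS : ∀ Γ ∈ S, ¬ Γ.Occurs q) (hqα : ¬ α.Occurs q)
    (hπ : ∀ Γ ∈ S, ∃ π : Deriv P C,
      π.IsProof {Δ | ∃ Θ ∈ S, Δ = ⟨Θ, {(.prop q, .f)}⟩} ⟨Γ, {(.dia α (.prop q), .f)}⟩ ∧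
        π.RightFocused)
    (hρ : ∀ Γ ∈ S, ∃ ρ : Deriv P C, ρ.IsProof Bs ⟨Γ, {(χ, .f)}⟩ ∧ ρ.RightFocused)
    (k : ℕ) : ∀ (V : Finset (Sequent P C)), (S \ V).card = k →
      ∀ base : List (SplitSequent P C × Option (AForm P C)),
      (∀ Θ ∈ V, ∃ pre post, base = pre ++
          (⟨Θ, {(.dia (.star α) χ, .f)}⟩, some (.dia (.star α) χ, .f)) :: post ∧
        ∀ x ∈ pre, x.1.Focused) →
      ∀ Γ ∈ S, ∃ d : Deriv P C, d.root = ⟨Γ, {(.dia (.star α) χ, .f)}⟩ ∧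
        d.Valid Bs base ∧ d.RightFocused := by
  have hfoc : ∀ (Γ : Sequent P C) φ, (SplitSequent.mk Γ {(φ, Ann.f)}).right.Focused :=
    fun Γ φ => ⟨_, Finset.mem_singleton_self _, rfl⟩
  induction k using Nat.strong_induction_on with
  | _ k ih =>
    intro V hV base hbase Γ hΓ
    by_cases hΓV : Γ ∈ V
    · obtain ⟨pre, post, rfl, hpre⟩ := hbase Γ hΓV
      refine ⟨.rep _, rfl, ⟨atMostOneFocus_singleton (hS Γ hΓ) _, pre, _, post, rfl, ?_, ?_⟩,
        .of_not_open (Deriv.not_open_rep _)⟩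
      · intro x hx
        rcases List.mem_append.1 hx with hx | hx
        · exact hpre x hx
        · rw [List.mem_singleton.1 hx]
          exact Or.inr (hfoc _ _)
      · exact ⟨_, List.mem_append_right _ (List.mem_singleton_self _), _, rfl⟩
    · set θ : Formula P C := .dia (.star α) χ with hθ
      obtain ⟨π, ⟨hπroot, hπval⟩, hπrf⟩ := hπ Γ hΓ
      obtain ⟨ρ, ⟨hρroot, hρval⟩, hρrf⟩ := hρ Γ hΓ
      have hsub : ∀ Θ ∈ S, ∀ A : AForm P C,
          SplitSequent.subst q θ ⟨Θ, {A}⟩ = ⟨Θ, {A.subst q θ}⟩ := fun Θ hΘ A => by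
        rw [SplitSequent.subst, Sequent.subst_of_not_occurs q θ (hqS Θ hΘ),
          Sequent.subst_singleton]
      have hcard : (S \ insert Γ V).card < k := by
        rw [← hV]
        refine Finset.card_lt_card (Finset.ssubset_iff_subset_ne.2
          ⟨Finset.sdiff_subset_sdiff le_rfl (Finset.subset_insert _ _), fun h => ?_⟩)
        have : Γ ∈ S \ insert Γ V := h ▸ Finset.mem_sdiff.2 ⟨hΓ, hΓV⟩
        simp at this
      obtain ⟨d, hd, hdval, hdrf, -⟩ := π.exists_subst q θ (Bs := Bs)
        (base := (⟨Γ, {(θ, .f)}⟩, some (θ, .f)) :: base)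
        (by
          rintro _ ⟨Θ, hΘ, rfl⟩ L hL
          rw [hsub Θ hΘ]
          have hq : AForm.subst q θ (.prop q, .f) = (θ, .f) := by
            simp only [AForm.subst, Formula.subst, if_true]
          rw [hq]
          refine ih _ hcard (insert Γ V) rfl _ ?_ Θ hΘ
          intro Ξ hΞ
          rcases Finset.mem_insert.1 hΞ with rfl | hΞ
          · exact ⟨L, base, rfl, fun x hx => Or.inr (hL x hx)⟩
          · obtain ⟨pre, post, rfl, hpre⟩ := hbase Ξ hΞ
            refine ⟨L ++ (⟨Γ, {(θ, .f)}⟩, some (θ, .f)) :: pre, post, by simp, ?_⟩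
            intro x hx
            rcases List.mem_append.1 hx with hx | hx
            · exact Or.inr (hL x hx)
            · rcases List.mem_cons.1 hx with rfl | hx
              · exact Or.inr (hfoc _ _)
              · exact hpre x hx)
        [] [] hπval hπrf (fun pre Θ A post h => by simp at h) (by simp)
      rw [hπroot, hsub Γ hΓ] at hd
      have hα : AForm.subst q θ (.dia α (.prop q), .f) = (.dia α θ, .f) := by
        simp only [AForm.subst, Formula.subst, if_true, α.subst_of_not_occurs q θ hqα]
      rw [hα] at hd
      refine ⟨.node ⟨Γ, {(θ, .f)}⟩ (some (θ, .f)) 2 ![ρ, d], rfl,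
        ⟨atMostOneFocus_singleton (hS Γ hΓ) _, ?_, ?_⟩, .node ?_ fun _ => hfoc _ _⟩
      · simpa [SplitSequent.add, List.ofFn_succ, hρroot, hd] using
          Rule.loc .r ⟨Γ, ∅⟩ _ _ (LocalRule.dia_star α χ .f)
      · rw [Fin.forall_fin_two]
        exact ⟨hρval.append _, hdval⟩
      · rw [Fin.forall_fin_two]
        exact ⟨hρrf, hdrf⟩

theorem exists_star_proof (S : Finset (Sequent P C)) (Bs : Set (SplitSequent P C))
    (α : Program P C) (q : P) (χ : Formula P C)
    (hS : ∀ Γ ∈ S, Γ.Unfocused) (hqS : ∀ Γ ∈ S, ¬ Γ.Occurs q) (hqα : ¬ α.Occurs q)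
    (hπ : ∀ Γ ∈ S, ∃ π : Deriv P C,
      π.IsProof {Δ | ∃ Θ ∈ S, Δ = ⟨Θ, {(.prop q, .f)}⟩} ⟨Γ, {(.dia α (.prop q), .f)}⟩ ∧
        π.RightFocused)
    (hρ : ∀ Γ ∈ S, ∃ ρ : Deriv P C, ρ.IsProof Bs ⟨Γ, {(χ, .f)}⟩ ∧ ρ.RightFocused) :
    ∀ Γ ∈ S, ∃ τ : Deriv P C, τ.IsProof Bs ⟨Γ, {(.dia (.star α) χ, .f)}⟩ ∧ τ.RightFocused := by
  intro Γ hΓ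
  obtain ⟨d, h1, h2, h3⟩ := exists_star_proof_aux S Bs α q χ hS hqS hqα hπ hρ _ ∅ rfl [] (by simp)
    Γ hΓ
  exact ⟨d, ⟨h1, h2⟩, h3⟩

end

end CPDL

theorem lemmal {P : Type u} {C : Type v}
    (S : Finset (CPDL.Sequent P C)) (As : Finset (CPDL.SplitSequent P C))
    (α : CPDL.Program P C) (q : P) (χ : CPDL.Formula P C) (o : CPDL.Ann)
    (hS : ∀ Γ ∈ S, CPDL.Sequent.Unfocused Γ)
    (hAs : ∀ Δ ∈ As, CPDL.SplitSequent.AtMostOneFocus Δ)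
    (hqS : ∀ Γ ∈ S, ¬ CPDL.Sequent.Occurs q Γ)
    (hqAs : ∀ Δ ∈ As, ¬ CPDL.SplitSequent.Occurs q Δ)
    (hqα : ¬ CPDL.Program.Occurs q α)
    (hπ : ∀ Γ ∈ S, ∃ π : CPDL.Deriv P C,
      π.IsProof {Δ | ∃ Θ ∈ S, Δ = ⟨Θ, {(.prop q, .f)}⟩} ⟨Γ, {(.dia α (.prop q), .f)}⟩ ∧
        π.RightFocused)
    (hρ : ∀ Γ ∈ S, ∃ ρ : CPDL.Deriv P C,
      ρ.IsProof (As : Set (CPDL.SplitSequent P C)) ⟨Γ, {(χ, o)}⟩ ∧ ρ.RightFocused) :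
    ∀ Γ ∈ S, ∃ τ : CPDL.Deriv P C,
      τ.IsProof (As : Set (CPDL.SplitSequent P C)) ⟨Γ, {(.dia (.star α) χ, o)}⟩ ∧
        τ.RightFocused := by
  cases o with
  | f => exact CPDL.exists_star_proof S As α q χ hS hqS hqα hπ hρ
  | u =>
    have hunf : ∀ Γ ∈ S, CPDL.SplitSequent.Unfocused (⟨Γ, ∅⟩ : CPDL.SplitSequent P C) :=
      fun Γ hΓ => ⟨hS Γ hΓ, by simp [CPDL.Sequent.Unfocused]⟩
    -- The root of `ρ` is unfocused, so `ρ` has no open leaf, and needs no assumptions.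
    have hρ' : ∀ Γ ∈ S, ∃ ρ : CPDL.Deriv P C, ρ.IsProof ∅ ⟨Γ, {(χ, .f)}⟩ ∧ ρ.RightFocused := by
      intro Γ hΓ
      obtain ⟨ρ, ⟨hroot, hval⟩, hrf⟩ := hρ Γ hΓ
      have hno : ¬ ρ.Open := fun ho => by
        obtain ⟨A, hA, hf⟩ := hrf.root ho
        rw [hroot, Finset.mem_singleton] at hA
        rw [hA] at hf
        cases hf
      have hval' : CPDL.Deriv.Valid ∅ [] (.node ⟨Γ, {(χ, .f)}⟩ none 1 fun _ => ρ) := by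
        refine ⟨CPDL.atMostOneFocus_singleton (hS Γ hΓ) _, ?_,
          fun _ => (hval.of_not_open hno).append _⟩
        simpa [CPDL.SplitSequent.add, hroot] using
          CPDL.Rule.unfocus .r ⟨Γ, ∅⟩ χ (hunf Γ hΓ)
      exact ⟨_, ⟨rfl, hval'⟩, .of_not_open hval'.not_open⟩
    intro Γ hΓ
    obtain ⟨τ, ⟨hroot, hval⟩, -⟩ := CPDL.exists_star_proof S ∅ α q χ hS hqS hqα hπ hρ' Γ hΓ
    have hval' : CPDL.Deriv.Valid ∅ []
        (.node ⟨Γ, {(.dia (.star α) χ, .u)}⟩ none 1 fun _ => τ) := by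
      refine ⟨CPDL.atMostOneFocus_singleton (hS Γ hΓ) _, ?_, fun _ => hval.append _⟩
      simpa [CPDL.SplitSequent.add, hroot] using
        CPDL.Rule.focus .r ⟨Γ, ∅⟩ (.dia (.star α) χ) (hunf Γ hΓ)
    exact ⟨_, ⟨rfl, hval'.of_not_open hval'.not_open⟩, .of_not_open hval'.not_open⟩
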